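/- Let $p\ge 1$ be an odd integer and let $t=(t_1=x,t_3,t_5,\dots)$ be the BKP times, near a base point $t=c$, where $c=(c_1,c_3,c_5,\dots)$ is a complex sequence with finitely many nonzero entries. Write $\partial=\partial/\partial x$ and $\partial_{2n+1}=\partial/\partial t_{2n+1}$. Let $$W=1+\sum_{j\ge1}w_j\,\partial^{-j}$$ be a wave operator of the BKP hierarchy, with coefficients $w_j$ that are formal power series over $\mathbb C$ in the variables $t_{2n+1}-c_{2n+1}$; that is, with $L=W\partial W^{-1}$, $$\partial_{2n+1}W=-(L^{2n+1})_-W\quad(n\ge0),\qquad W^*\partial W=\partial ,$$ where $P_-$ is the part of $P$ with negative powers of $\partial$ and $P^*$ is the formal adjoint. Let $\xi(t,z)=\sum_{n\ge0}t_{2n+1}z^{2n+1}$, let $\omega(t,z)=We^{\xi(t,z)}=(1+w_1z^{-1}+w_2z^{-2}+\cdots)e^{\xi(t,z)}$ be the wave function, and let $$V^0=\operatorname{span}_{\mathbb C}\{\partial_x^k\omega(t,z)|_{t=c}:k\ge0\}\subset e^{\xi(c,z)}\,\mathbb C((z^{-1})).$$ (For $c=0$ the factor $e^{\xi(c,z)}$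 is $1$.) Let $M=W\Gamma W^{-1}$ with $\Gamma=\sum_{n\ge0}(2n+1)t_{2n+1}\partial^{2n}$ be the Orlov–Schulman operator, let $A_{m,l}(L,M)=M^mL^l-(-1)^lL^{l-1}M^mL$, and let $$A_{2p}=z^{p}\,\frac{d}{dz^{2p}}\,z^{-p},\qquad \frac{d}{dz^{2p}}=\frac1{2p}\,z^{1-2p}\frac{d}{dz}.$$ Then: 1. $V^0$ belongs to the big cell of the Sato Grassmannian: $e^{\xi(c,z)}\mathbb C((z^{-1}))=V^0\oplus e^{\xi(c,z)}H_-$ with $H_-=z^{-1}\mathbb C[[z^{-1}]]$. 2. If the hierarchy is $p$-reduced, i.e. $(L^p)_-=0$, then $z^pV^0\subset V^0$. 3. If the string equation holds in the form of stationarity under the additional flow $\hat\partial_{1,1-2p}W=-(A_{1,1-2p}(L,M))_-W$, i.e. $(A_{1,1-2p}(L,M))_-=0$ (equivalently $(ML^{1-2p})_-=pL^{-2p}$), then $A_{2p}V^0\subset V^0$. 4. $[A_{2p},z^{2p}]=1$. -/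

import Mathlib

noncomputable section

/-- Formal pseudo-differential operators `∑_{k ≤ N} a_k ∂^k` (with some bound `N` on the order) over a
commutative ring `R`, where `∂` acts on `R` through the derivation `δ`. -/
@[ext]
structure PsiDO {K R : Type*} [CommRing K] [CommRing R] [Algebra K R] (δ : Derivation K R R) where
  coeff : ℤ → R
  bdd' : ∃ N : ℤ, ∀ k, N < k → coeff k = 0

namespace PsiDO

open Finset

variable {K R : Type*} [CommRing K] [CommRing R] [Algebra K R] {δ : Derivation K R R}

instance : Zero (PsiDO δ) := ⟨⟨0, 0, fun _ _ => rfl⟩⟩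

instance : Add (PsiDO δ) := ⟨fun a b => ⟨a.coeff + b.coeff, by
  obtain ⟨A, hA⟩ := a.bdd'
  obtain ⟨B, hB⟩ := b.bdd'
  refine ⟨max A B, fun k hk => ?_⟩
  simp [hA k (lt_of_le_of_lt (le_max_left _ _) hk), hB k (lt_of_le_of_lt (le_max_right _ _) hk)]⟩⟩

instance : Neg (PsiDO δ) := ⟨fun a => ⟨-a.coeff, by
  obtain ⟨A, hA⟩ := a.bdd'
  exact ⟨A, fun k hk => by simp [hA k hk]⟩⟩⟩

@[simp] theorem coeff_zero (k : ℤ) : (0 : PsiDO δ).coeff k = 0 := rfl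
@[simp] theorem coeff_add (a b : PsiDO δ) (k : ℤ) : (a + b).coeff k = a.coeff k + b.coeff k := rfl
@[simp] theorem coeff_neg (a : PsiDO δ) (k : ℤ) : (-a).coeff k = -a.coeff k := rfl

instance : AddCommGroup (PsiDO δ) where
  add_assoc a b c := by ext k; simp [add_assoc]
  zero_add a := by ext k; simp
  add_zero a := by ext k; simp
  nsmul := nsmulRec
  zsmul := zsmulRec
  neg_add_cancel a := by ext k; simp
  add_comm a b := by ext k; simp [add_comm]

/-- The operator `r ∂^i`. -/
def single (i : ℤ) (r : R) : PsiDO δ where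
  coeff := Pi.single i r
  bdd' := ⟨i, fun k hk => by simp [hk.ne']⟩

theorem coeff_single (i : ℤ) (r : R) (k : ℤ) :
    (single i r : PsiDO δ).coeff k = if k = i then r else 0 := by
  simp [single, Pi.single_apply]

instance : One (PsiDO δ) := ⟨single 0 1⟩

theorem one_def : (1 : PsiDO δ) = single 0 1 := rfl

variable (δ) in
/-- The coefficient of `∂^k` in `(a_i ∂^i) (b_q ∂^q) = ∑_{j ≥ 0} (i choose j) a_i δ^j(b_q) ∂^(i+q-j)`. -/
def mulTerm (a b : ℤ → R) (k i q : ℤ) : R :=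
  if k ≤ i + q then
    Ring.choose i (i + q - k).toNat • (a i * δ^[(i + q - k).toNat] (b q))
  else 0

variable (δ) in
/-- The coefficient of `∂^k` in the product of two operators. -/
def mulCoeff (a b : ℤ → R) (k : ℤ) : R :=
  ∑ᶠ x : ℤ × ℤ, mulTerm δ a b k x.1 x.2

theorem iter_zero (n : ℕ) : δ^[n] 0 = 0 :=
  Function.iterate_fixed (map_zero δ) n

theorem iter_add (n : ℕ) (a b : R) : δ^[n] (a + b) = δ^[n] a + δ^[n] b :=
  iterate_map_add δ n a b

theorem iter_sum {ι : Type*} (n : ℕ) (s : Finset ι) (f : ι → R) :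
    δ^[n] (∑ x ∈ s, f x) = ∑ x ∈ s, δ^[n] (f x) := by
  classical
  induction s using Finset.induction_on with
  | empty => simp
  | insert x s hx ih => rw [Finset.sum_insert hx, Finset.sum_insert hx, iter_add, ih]

theorem iter_zsmul (n : ℕ) (m : ℤ) (a : R) : δ^[n] (m • a) = m • δ^[n] a := by
  induction n generalizing a with
  | zero => rfl
  | succ n ih => rw [Function.iterate_succ_apply, map_zsmul, ih, Function.iterate_succ_apply]

theorem iter_mul (n : ℕ) (a b : R) :
    δ^[n] (a * b) = ∑ x ∈ antidiagonal n, n.choose x.1 • (δ^[x.1] a * δ^[x.2] b) := by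
  induction n with
  | zero => simp
  | succ n ih =>
    rw [Finset.sum_antidiagonal_choose_succ_nsmul (fun i j => δ^[i] a * δ^[j] b) n,
      Function.iterate_succ_apply', ih, map_sum, ← Finset.sum_add_distrib]
    refine Finset.sum_congr rfl fun x hx => ?_
    have hc : n.choose x.2 = n.choose x.1 := by
      rw [← Nat.choose_symm_of_eq_add]
      rw [← HasAntidiagonal.mem_antidiagonal.1 hx]
    rw [map_nsmul, Derivation.leibniz, hc, Function.iterate_succ_apply',
      Function.iterate_succ_apply', smul_add, smul_eq_mul, smul_eq_mul,
      mul_comm (δ^[x.2] b)]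

theorem mulCoeff_eq_sum {a b : ℤ → R} {A B lo : ℤ} {k : ℤ} (ha : ∀ i, A < i → a i = 0)
    (hb : ∀ i, B < i → b i = 0) (h1 : lo ≤ k - A) (h2 : lo ≤ k - B) {A' B' : ℤ}
    (hA : A ≤ A') (hB : B ≤ B') :
    mulCoeff δ a b k = ∑ i ∈ Icc lo A', ∑ q ∈ Icc lo B', mulTerm δ a b k i q := by
  rw [mulCoeff, ← Finset.sum_product']
  refine finsum_eq_sum_of_support_subset _ fun x hx => ?_
  simp only [Function.mem_support, mulTerm] at hx
  have hk : k ≤ x.1 + x.2 := by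
    by_contra h
    simp [h] at hx
  have hi : x.1 ≤ A := by
    by_contra h
    simp [ha _ (not_le.1 h)] at hx
  have hq : x.2 ≤ B := by
    by_contra h
    simp [hb _ (not_le.1 h)] at hx
  simp only [coe_product, coe_Icc, Set.mem_prod, Set.mem_Icc]
  omega

instance : Mul (PsiDO δ) := ⟨fun a b => ⟨mulCoeff δ a.coeff b.coeff, by
  obtain ⟨A, hA⟩ := a.bdd'
  obtain ⟨B, hB⟩ := b.bdd'
  refine ⟨A + B, fun k hk => ?_⟩
  rw [mulCoeff_eq_sum (lo := min (k - A) (k - B)) hA hB (min_le_left _ _) (min_le_right _ _)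
    le_rfl le_rfl]
  refine Finset.sum_eq_zero fun i hi => Finset.sum_eq_zero fun q hq => ?_
  rw [Finset.mem_Icc] at hi hq
  rw [mulTerm, if_neg (by omega)]⟩⟩

theorem coeff_mul (a b : PsiDO δ) (k : ℤ) :
    (a * b).coeff k = mulCoeff δ a.coeff b.coeff k := rfl

/-- A common bound for the orders of finitely many operators. -/
theorem exists_bound₃ (a b c : PsiDO δ) : ∃ N : ℤ, 0 ≤ N ∧ (∀ k, N < k → a.coeff k = 0) ∧
    (∀ k, N < k → b.coeff k = 0) ∧ (∀ k, N < k → c.coeff k = 0) := by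
  obtain ⟨A, hA⟩ := a.bdd'
  obtain ⟨B, hB⟩ := b.bdd'
  obtain ⟨C, hC⟩ := c.bdd'
  refine ⟨max 0 (max A (max B C)), le_max_left _ _, fun k hk => hA k ?_, fun k hk => hB k ?_,
    fun k hk => hC k ?_⟩ <;> omega

theorem coeff_mul_eq_sum (a b : PsiDO δ) {A B lo k : ℤ} (ha : ∀ i, A < i → a.coeff i = 0)
    (hb : ∀ i, B < i → b.coeff i = 0) (h1 : lo ≤ k - A) (h2 : lo ≤ k - B) {A' B' : ℤ}
    (hA : A ≤ A') (hB : B ≤ B') :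
    (a * b).coeff k =
      ∑ i ∈ Icc lo A', ∑ q ∈ Icc lo B', mulTerm δ a.coeff b.coeff k i q :=
  mulCoeff_eq_sum ha hb h1 h2 hA hB

protected theorem left_distrib (a b c : PsiDO δ) : a * (b + c) = a * b + a * c := by
  ext k
  obtain ⟨N, -, hA, hB, hC⟩ := exists_bound₃ a b c
  have hBC : ∀ i, N < i → (b + c).coeff i = 0 := fun i hi => by simp [hB i hi, hC i hi]
  rw [coeff_add, coeff_mul_eq_sum a (b + c) hA hBC le_rfl le_rfl le_rfl le_rfl,
    coeff_mul_eq_sum a b hA hB le_rfl le_rfl le_rfl le_rfl,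
    coeff_mul_eq_sum a c hA hC le_rfl le_rfl le_rfl le_rfl]
  simp only [← Finset.sum_add_distrib]
  refine Finset.sum_congr rfl fun i _ => Finset.sum_congr rfl fun q _ => ?_
  simp only [mulTerm, coeff_add, iter_add]
  split_ifs <;> simp [mul_add]

protected theorem right_distrib (a b c : PsiDO δ) : (a + b) * c = a * c + b * c := by
  ext k
  obtain ⟨N, -, hA, hB, hC⟩ := exists_bound₃ a b c
  have hAB : ∀ i, N < i → (a + b).coeff i = 0 := fun i hi => by simp [hA i hi, hB i hi]
  rw [coeff_add, coeff_mul_eq_sum (a + b) c hAB hC le_rfl le_rfl le_rfl le_rfl,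
    coeff_mul_eq_sum a c hA hC le_rfl le_rfl le_rfl le_rfl,
    coeff_mul_eq_sum b c hB hC le_rfl le_rfl le_rfl le_rfl]
  simp only [← Finset.sum_add_distrib]
  refine Finset.sum_congr rfl fun i _ => Finset.sum_congr rfl fun q _ => ?_
  simp only [mulTerm, coeff_add]
  split_ifs <;> simp [add_mul]

theorem iter_one {n : ℕ} (hn : n ≠ 0) : δ^[n] (1 : R) = 0 := by
  obtain ⟨m, rfl⟩ := Nat.exists_eq_succ_of_ne_zero hn
  rw [Function.iterate_succ_apply, Derivation.map_one_eq_zero, iter_zero]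

protected theorem mul_single_one (a : PsiDO δ) (j k : ℤ) :
    (a * single j 1).coeff k = a.coeff (k - j) := by
  rw [coeff_mul, mulCoeff, finsum_eq_single _ (k - j, j)]
  · simp [mulTerm, coeff_single]
  · rintro ⟨i, q⟩ hx
    simp only [mulTerm, coeff_single]
    split_ifs with h1 h2
    · have : (i + q - k).toNat ≠ 0 := by
        intro h
        apply hx
        ext <;> simp <;> omega
      simp [iter_one this]
    · simp
    · rfl

protected theorem one_mul (a : PsiDO δ) : 1 * a = a := by
  ext k
  rw [coeff_mul, mulCoeff, finsum_eq_single _ (0, k)]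
  · simp [mulTerm, one_def, coeff_single]
  · rintro ⟨i, q⟩ hx
    simp only [mulTerm, one_def, coeff_single]
    split_ifs with h1 h2
    · subst h2
      have : 0 < (0 + q - k).toNat := by
        rw [Nat.pos_iff_ne_zero]
        intro h
        apply hx
        ext
        · simp
        · simp
          omega
      rw [Ring.choose_zero_pos ℤ this]
      simp
    · simp
    · rfl

theorem sum_Icc_eq_antidiagonal {g : ℤ → R} {x y s : ℤ} {D : ℕ} (hx : x ≤ s - D) (hy : s ≤ y)
    (h1 : ∀ i, i < s - D → g i = 0) (h2 : ∀ i, s < i → g i = 0) :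
    ∑ i ∈ Icc x y, g i = ∑ p ∈ antidiagonal D, g (s - p.1) := by
  symm
  refine Finset.sum_of_injOn (fun p : ℕ × ℕ => s - (p.1 : ℤ)) ?_ ?_ ?_ (fun _ _ => rfl)
  · intro p hp q hq hpq
    simp only [mem_coe, HasAntidiagonal.mem_antidiagonal] at hp hq
    simp only at hpq
    ext <;> omega
  · intro p hp
    rw [mem_coe, HasAntidiagonal.mem_antidiagonal] at hp
    simp only [coe_Icc, Set.mem_Icc]
    omega
  · intro i hi hn
    by_contra hg
    apply hn
    have ha : s - D ≤ i := not_lt.1 fun h => hg (h1 i h)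
    have hb : i ≤ s := not_lt.1 fun h => hg (h2 i h)
    refine ⟨((s - i).toNat, D - (s - i).toNat), ?_, ?_⟩
    · rw [mem_coe, HasAntidiagonal.mem_antidiagonal]
      omega
    · simp only
      omega

theorem assoc_core (l q : ℤ) (D : ℕ) (α β γ : R) :
    ∑ x ∈ antidiagonal D, Ring.choose (l + q - x.1) x.2 •
        (Ring.choose l x.1 • (α * δ^[x.1] β) * δ^[x.2] γ) =
      ∑ x ∈ antidiagonal D, Ring.choose l x.2 •
        (α * δ^[x.2] (Ring.choose q x.1 • (β * δ^[x.1] γ))) := by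
  have hL : ∀ x ∈ antidiagonal D, Ring.choose (l + q - x.1) x.2 •
        (Ring.choose l x.1 • (α * δ^[x.1] β) * δ^[x.2] γ) =
      ∑ y ∈ antidiagonal x.2, (Ring.choose l x.1 * Ring.choose (l - x.1) y.1 * Ring.choose q y.2) •
        (α * δ^[x.1] β * δ^[y.1 + y.2] γ) := by
    intro x _
    rw [show l + q - x.1 = (l - x.1) + q by ring,
      Ring.add_choose_eq _ (Commute.all _ _), Finset.sum_smul]
    refine Finset.sum_congr rfl fun y hy => ?_
    rw [HasAntidiagonal.mem_antidiagonal.1 hy, smul_mul_assoc, smul_smul]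
    congr 1
    ring
  have hR : ∀ x ∈ antidiagonal D, Ring.choose l x.2 •
        (α * δ^[x.2] (Ring.choose q x.1 • (β * δ^[x.1] γ))) =
      ∑ y ∈ antidiagonal x.2, (Ring.choose l y.1 * Ring.choose (l - y.1) y.2 * Ring.choose q x.1) •
        (α * δ^[y.1] β * δ^[y.2 + x.1] γ) := by
    intro x _
    rw [iter_zsmul, iter_mul, Finset.smul_sum, Finset.mul_sum, Finset.smul_sum]
    refine Finset.sum_congr rfl fun y hy => ?_
    have hy' := HasAntidiagonal.mem_antidiagonal.1 hy
    have h := Ring.choose_smul_choose l (n := x.2) (k := y.1) (by omega)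
    rw [show x.2 - y.1 = y.2 by omega] at h
    rw [← h, Function.iterate_add_apply, ← natCast_zsmul, mul_smul_comm, mul_smul_comm, smul_smul,
      smul_smul, mul_assoc α, nsmul_eq_mul]
    congr 1
    ring
  rw [Finset.sum_congr rfl hL, Finset.sum_congr rfl hR, Finset.sum_sigma', Finset.sum_sigma']
  refine Finset.sum_nbij' (fun s => ⟨(s.2.2, s.1.1 + s.2.1), (s.1.1, s.2.1)⟩)
    (fun s => ⟨(s.2.1, s.2.2 + s.1.1), (s.2.2, s.1.1)⟩) ?_ ?_ ?_ ?_ ?_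
  · rintro ⟨⟨x1, x2⟩, ⟨y1, y2⟩⟩ h
    simp only [mem_sigma, HasAntidiagonal.mem_antidiagonal] at h ⊢
    obtain ⟨h1, h2⟩ := h
    refine ⟨?_, trivial⟩
    omega
  · rintro ⟨⟨x1, x2⟩, ⟨y1, y2⟩⟩ h
    simp only [mem_sigma, HasAntidiagonal.mem_antidiagonal] at h ⊢
    obtain ⟨h1, h2⟩ := h
    refine ⟨?_, trivial⟩
    omega
  · rintro ⟨⟨x1, x2⟩, ⟨y1, y2⟩⟩ h
    simp only [mem_sigma, HasAntidiagonal.mem_antidiagonal] at h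
    obtain ⟨h1, rfl⟩ := h
    rfl
  · rintro ⟨⟨x1, x2⟩, ⟨y1, y2⟩⟩ h
    simp only [mem_sigma, HasAntidiagonal.mem_antidiagonal] at h
    obtain ⟨h1, rfl⟩ := h
    rfl
  · rintro ⟨⟨x1, x2⟩, ⟨y1, y2⟩⟩ h
    rfl

protected theorem mul_assoc (a b c : PsiDO δ) : a * b * c = a * (b * c) := by
  ext k
  obtain ⟨N, hN, hA, hB, hC⟩ := exists_bound₃ a b c
  obtain ⟨H, hH, hAB, hBC, -⟩ := exists_bound₃ (a * b) (b * c) 0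
  -- enlarge to one common bound
  have key : ∀ M : ℤ, 0 ≤ M → N ≤ M → H ≤ M → (a * b * c).coeff k = (a * (b * c)).coeff k := by
    intro M hM hNM hHM
    have hA' : ∀ i, M < i → a.coeff i = 0 := fun i hi => hA i (by omega)
    have hB' : ∀ i, M < i → b.coeff i = 0 := fun i hi => hB i (by omega)
    have hC' : ∀ i, M < i → c.coeff i = 0 := fun i hi => hC i (by omega)
    have hAB' : ∀ i, M < i → (a * b).coeff i = 0 := fun i hi => hAB i (by omega)
    have hBC' : ∀ i, M < i → (b * c).coeff i = 0 := fun i hi => hBC i (by omega)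
    set I := Icc (k - 2 * M) M with hI
    set J := Icc (k - M) (2 * M) with hJ
    have e1 : (a * b * c).coeff k = ∑ i ∈ J, ∑ r ∈ I, mulTerm δ (a * b).coeff c.coeff k i r := by
      rw [coeff_mul_eq_sum (a * b) c (lo := k - 2 * M) hAB' hC' (by omega) (by omega)
        (A' := 2 * M) (by omega) le_rfl]
      symm
      refine Finset.sum_subset (Finset.Icc_subset_Icc (by omega) le_rfl) fun i hi hn => ?_
      refine Finset.sum_eq_zero fun r hr => ?_
      simp only [hI, hJ, mem_Icc] at hi hn hr
      rw [mulTerm, if_neg (by omega)]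
    have e2 : (a * (b * c)).coeff k = ∑ l ∈ I, ∑ i ∈ J, mulTerm δ a.coeff (b * c).coeff k l i := by
      rw [coeff_mul_eq_sum a (b * c) (lo := k - 2 * M) hA' hBC' (by omega) (by omega)
        le_rfl (B' := 2 * M) (by omega)]
      refine Finset.sum_congr rfl fun l hl => ?_
      symm
      refine Finset.sum_subset (Finset.Icc_subset_Icc (by omega) le_rfl) fun i hi hn => ?_
      simp only [hI, hJ, mem_Icc] at hi hn hl
      rw [mulTerm, if_neg (by omega)]
    have i1 : ∀ i ∈ J, (a * b).coeff i =
        ∑ l ∈ I, ∑ q ∈ I, mulTerm δ a.coeff b.coeff i l q := fun i hi => by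
      simp only [hJ, mem_Icc] at hi
      exact coeff_mul_eq_sum a b hA' hB' (by omega) (by omega) le_rfl le_rfl
    have i2 : ∀ i ∈ J, (b * c).coeff i =
        ∑ q ∈ I, ∑ r ∈ I, mulTerm δ b.coeff c.coeff i q r := fun i hi => by
      simp only [hJ, mem_Icc] at hi
      exact coeff_mul_eq_sum b c hB' hC' (by omega) (by omega) le_rfl le_rfl
    have f1 : (a * b * c).coeff k = ∑ l ∈ I, ∑ q ∈ I, ∑ r ∈ I, ∑ i ∈ J,
        mulTerm δ (fun i => mulTerm δ a.coeff b.coeff i l q) c.coeff k i r := by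
      rw [e1]
      have : ∀ i ∈ J, ∀ r ∈ I, mulTerm δ (a * b).coeff c.coeff k i r =
          ∑ l ∈ I, ∑ q ∈ I, mulTerm δ (fun i => mulTerm δ a.coeff b.coeff i l q) c.coeff k i r := by
        intro i hi r _
        simp only [mulTerm.eq_1 δ (a * b).coeff, i1 i hi,
          mulTerm.eq_1 δ (fun i => mulTerm δ a.coeff b.coeff i _ _)]
        split_ifs
        · simp only [Finset.sum_mul, Finset.smul_sum]
        · simp
      rw [Finset.sum_congr rfl fun i hi => Finset.sum_congr rfl fun r hr => this i hi r hr]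
      rw [Finset.sum_comm]
      rw [Finset.sum_congr rfl fun r _ => Finset.sum_comm]
      rw [Finset.sum_comm]
      refine Finset.sum_congr rfl fun l _ => ?_
      rw [Finset.sum_congr rfl fun r _ => Finset.sum_comm]
      rw [Finset.sum_comm]
    have f2 : (a * (b * c)).coeff k = ∑ l ∈ I, ∑ q ∈ I, ∑ r ∈ I, ∑ i ∈ J,
        mulTerm δ a.coeff (fun i => mulTerm δ b.coeff c.coeff i q r) k l i := by
      rw [e2]
      refine Finset.sum_congr rfl fun l _ => ?_
      have : ∀ i ∈ J, mulTerm δ a.coeff (b * c).coeff k l i =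
          ∑ q ∈ I, ∑ r ∈ I, mulTerm δ a.coeff (fun i => mulTerm δ b.coeff c.coeff i q r) k l i := by
        intro i hi
        simp only [mulTerm.eq_1 δ a.coeff (b * c).coeff, i2 i hi,
          mulTerm.eq_1 δ a.coeff (fun i => mulTerm δ b.coeff c.coeff i _ _)]
        split_ifs
        · simp only [iter_sum, Finset.mul_sum, Finset.smul_sum]
        · simp
      rw [Finset.sum_congr rfl this, Finset.sum_comm]
      exact Finset.sum_congr rfl fun q _ => Finset.sum_comm
    rw [f1, f2]
    refine Finset.sum_congr rfl fun l hl => Finset.sum_congr rfl fun q hq =>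
      Finset.sum_congr rfl fun r hr => ?_
    simp only [hI, mem_Icc] at hl hq hr
    by_cases hD : k ≤ l + q + r
    · obtain ⟨D, hD⟩ : ∃ D : ℕ, l + q + r - k = D := ⟨(l + q + r - k).toNat, by omega⟩
      rw [hJ, sum_Icc_eq_antidiagonal (s := l + q) (D := D) (by omega) (by omega),
        sum_Icc_eq_antidiagonal (s := q + r) (D := D) (by omega) (by omega)]
      · convert assoc_core (δ := δ) l q D (a.coeff l) (b.coeff q) (c.coeff r) using 1
        · refine Finset.sum_congr rfl fun x hx => ?_
          have hx' := HasAntidiagonal.mem_antidiagonal.1 hx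
          simp only [mulTerm]
          rw [if_pos (by omega), if_pos (by omega),
            show (l + q - x.1 + r - k).toNat = x.2 by omega,
            show (l + q - (l + q - x.1)).toNat = x.1 by omega]
        · refine Finset.sum_congr rfl fun x hx => ?_
          have hx' := HasAntidiagonal.mem_antidiagonal.1 hx
          simp only [mulTerm]
          rw [if_pos (by omega), if_pos (by omega),
            show (l + (q + r - x.1) - k).toNat = x.2 by omega,
            show (q + r - (q + r - x.1)).toNat = x.1 by omega]
      · intro i hi
        rw [mulTerm, if_neg (by omega)]
      · intro i hi
        simp only [mulTerm]
        rw [if_neg (c := i ≤ q + r) (by omega)]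
        simp
      · intro i hi
        rw [mulTerm, if_neg (by omega)]
      · intro i hi
        simp only [mulTerm]
        rw [if_neg (c := i ≤ l + q) (by omega)]
        simp
    · rw [Finset.sum_eq_zero, Finset.sum_eq_zero]
      · intro i _
        simp only [mulTerm]
        by_cases h : i ≤ q + r
        · rw [if_neg (by omega)]
        · simp [h]
      · intro i _
        simp only [mulTerm]
        by_cases h : i ≤ l + q
        · rw [if_neg (by omega)]
        · simp [h]
  exact key (max N H) (by omega) (by omega) (by omega)

protected theorem mul_zero (a : PsiDO δ) : a * 0 = 0 := by
  have h := PsiDO.left_distrib a 0 0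
  rwa [add_zero, left_eq_add] at h

protected theorem zero_mul (a : PsiDO δ) : 0 * a = 0 := by
  have h := PsiDO.right_distrib 0 0 a
  rwa [add_zero, left_eq_add] at h

instance : Ring (PsiDO δ) where
  left_distrib := PsiDO.left_distrib
  right_distrib := PsiDO.right_distrib
  mul_assoc := PsiDO.mul_assoc
  one_mul := PsiDO.one_mul
  mul_one a := by
    ext k
    rw [one_def, PsiDO.mul_single_one, sub_zero]
  zero_mul := PsiDO.zero_mul
  mul_zero := PsiDO.mul_zero
  neg_add_cancel := neg_add_cancel
  zsmul := zsmulRec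

theorem single_mul_single (i j : ℤ) :
    (single i 1 * single j 1 : PsiDO δ) = single (i + j) 1 := by
  ext k
  rw [PsiDO.mul_single_one, coeff_single, coeff_single]
  simp only [sub_eq_iff_eq_add]

variable (δ) in
/-- The operator `∂`, which is invertible. -/
def D : (PsiDO δ)ˣ where
  val := single 1 1
  inv := single (-1) 1
  val_inv := by rw [single_mul_single]; rfl
  inv_val := by rw [single_mul_single]; rfl

/-- The part `P_- = ∑_{k < 0} a_k ∂^k` of `P = ∑ a_k ∂^k`. -/
def negPart (P : PsiDO δ) : PsiDO δ where
  coeff k := if k < 0 then P.coeff k else 0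
  bdd' := ⟨0, fun _ hk => if_neg (not_lt.2 hk.le)⟩

/-- The formal adjoint `P^* = ∑ (-∂)^i a_i` of `P = ∑ a_i ∂^i`; since
`(-∂)^i a_i = (-1)^i ∑_{j ≥ 0} (i choose j) δ^j(a_i) ∂^(i-j)`, the coefficient of `∂^k` collects
`i = k + j`. -/
def adjoint (P : PsiDO δ) : PsiDO δ where
  coeff k := ∑ᶠ j : ℕ,
    ((Int.negOnePow (k + j) : ℤ) * Ring.choose (k + j) j) • δ^[j] (P.coeff (k + j))
  bdd' := by
    obtain ⟨N, hN⟩ := P.bdd'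
    refine ⟨N, fun k hk => ?_⟩
    rw [finsum_eq_zero_of_forall_eq_zero]
    intro j
    rw [hN _ (by omega)]
    simp

end PsiDO

namespace BKP

/-- Functions of the BKP times, as formal power series about a base point
`c = (c_0, c_1, …)`: the variable of index `n` is `s_n = t_{2n+1} - c_n`. -/
abbrev Coef : Type := MvPowerSeries ℕ ℂ

/-- The flow derivative `∂_{2n+1} = ∂/∂t_{2n+1}`. In particular `dt 0 = ∂_x`, as `x = t_1`. -/
abbrev dt (n : ℕ) : Derivation ℂ Coef Coef := MvPowerSeries.pderiv ℂ n

/-- Pseudo-differential operators in `x = t_1`. -/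
abbrev Op : Type := PsiDO (dt 0)

/-- The Lax operator `L = W ∂ W⁻¹`, which is invertible. -/
def lax (W : Opˣ) : Opˣ := W * PsiDO.D (dt 0) * W⁻¹

/-- `W` is a wave (dressing, Sato) operator of the BKP hierarchy. -/
structure IsWaveOperator (W : Opˣ) : Prop where
  /-- `W = 1 + w_1 ∂^{-1} + w_2 ∂^{-2} + ⋯` -/
  coeff_zero : (W : Op).coeff 0 = 1
  coeff_pos : ∀ k : ℤ, 0 < k → (W : Op).coeff k = 0
  /-- The Sato equations `∂_{2n+1} W = -(L^{2n+1})_- W`. -/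
  sato : ∀ (n : ℕ) (k : ℤ), dt n ((W : Op).coeff k) =
    (-(((lax W : Op) ^ (2 * n + 1)).negPart * (W : Op))).coeff k
  /-- The BKP constraint `W^* ∂ W = ∂`. -/
  constraint : (W : Op).adjoint * (PsiDO.D (dt 0) : Op) * (W : Op) = (PsiDO.D (dt 0) : Op)

/-- The `p`-reduced hierarchy: `L^p = (L^p)_+`, that is, `(L^p)_- = 0`. -/
def IsReduced (p : ℕ) (W : Opˣ) : Prop := ((lax W : Op) ^ p).negPart = 0

/-- The partial sum `∑_{n < N} (2n+1) t_{2n+1} ∂^{2n}` of `Γ`, where `t_{2n+1} = c_n + s_n`. -/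
def gammaSum (c : ℕ →₀ ℂ) (N : ℕ) : Op :=
  ∑ n ∈ Finset.range N, PsiDO.single (2 * n : ℤ)
    ((2 * n + 1 : Coef) * (MvPowerSeries.C (c n) + MvPowerSeries.X n))

/-- The partial sums `M_N = W Γ_N W⁻¹` of the Orlov-Schulman operator `M = W Γ W⁻¹`. -/
def orlovSchulmanSum (c : ℕ →₀ ℂ) (W : Opˣ) (N : ℕ) : Op :=
  (W : Op) * gammaSum c N * ((W⁻¹ : Opˣ) : Op)

/-- The generator `A_{ml}(L, M) = M^m L^l - (-1)^l L^{l-1} M^m L` of additional symmetries. -/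
def generator (m : ℕ) (l : ℤ) (L : Opˣ) (M : Op) : Op :=
  M ^ m * ((L ^ l : Opˣ) : Op) -
    (Int.negOnePow l : ℤ) • (((L ^ (l - 1) : Opˣ) : Op) * M ^ m * (L : Op))

/-- The string equation, as stationarity of the additional flow
`∂̂_{1,1-2p} W = -(A_{1,1-2p}(L, M))_- W = 0`, that is, `(A_{1,1-2p}(L, M))_- = 0`.
The operator `Γ = ∑_n (2n+1) t_{2n+1} ∂^{2n}` is an infinite sum, so `A_{1,1-2p}(L, M)` is the
coefficientwise limit of `A_{1,1-2p}(L, M_N)` as `N → ∞`: since `c` is finitely supported, every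
coefficient (of a monomial `s^d` in the factor of a power `∂^k`) is eventually constant in `N`. -/
def StringEquation (p : ℕ) (c : ℕ →₀ ℂ) (W : Opˣ) : Prop :=
  ∀ k : ℤ, k < 0 → ∀ d : ℕ →₀ ℕ, ∀ᶠ N : ℕ in Filter.atTop,
    MvPowerSeries.coeff d
      ((generator 1 (1 - 2 * p) (lax W) (orlovSchulmanSum c W N)).coeff k) = 0

/-- The series `ŵ(t, z) = 1 + w_1/z + w_2/z^2 + ⋯` in the wave function
`ω(t, z) = W e^{ξ(t, z)} = ŵ(t, z) e^{ξ(t, z)}`, where `ξ(t, z) = ∑ t_{2n+1} z^{2n+1}`.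
In all series in `z`, the coefficient of index `n` is the one of `z^{-n}`. -/
def waveSeries (W : Opˣ) : LaurentSeries Coef :=
  HahnSeries.ofSuppBddBelow (fun n => (W : Op).coeff (-n)) (by
    obtain ⟨N, hN⟩ := (W : Op).bdd'
    refine ⟨-N, fun n hn => ?_⟩
    by_contra h
    exact hn (hN _ (by omega)))

/-- `∂_x` on series `f e^{ξ(t, z)}`, in terms of `f`: `∂_x (f e^ξ) = (∂_x f + z f) e^ξ`. -/
def dxWave (f : LaurentSeries Coef) : LaurentSeries Coef :=
  HahnSeries.map f (dt 0) + HahnSeries.single (-1) 1 * f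

/-- The value at the base point `t = c` (that is, `s = 0`) of the series `f`. -/
def atBase (f : LaurentSeries Coef) : LaurentSeries ℂ :=
  HahnSeries.map f (MvPowerSeries.constantCoeff (σ := ℕ) (R := ℂ))

/-- The plane `V⁰ = span {ω, ∂_x ω, ∂_x^2 ω, …}` at `t = c`. Its elements `f(z) e^{ξ(c, z)}` are
represented by the formal series `f ∈ ℂ((1/z))`; for `c = 0` the factor `e^{ξ(c, z)}` is `1`. -/
def plane (W : Opˣ) : Submodule ℂ (LaurentSeries ℂ) :=
  Submodule.span ℂ (Set.range fun k : ℕ => atBase (dxWave^[k] (waveSeries W)))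

/-- `H_-`, the series in `z^{-1}, z^{-2}, …`. -/
def Hminus : Submodule ℂ (LaurentSeries ℂ) where
  carrier := {f | ∀ n : ℤ, n ≤ 0 → f.coeff n = 0}
  add_mem' hf hg n hn := by simp [hf n hn, hg n hn]
  zero_mem' n _ := by simp
  smul_mem' a f hf n hn := by simp [hf n hn]

/-- Multiplication by `z^k`. -/
def zMul (k : ℤ) : Module.End ℂ (LaurentSeries ℂ) :=
  { toFun := fun f => HahnSeries.single (-k) 1 * f
    map_add' := fun f g => mul_add _ f g
    map_smul' := fun a f => by
      rw [RingHom.id_apply, ← HahnSeries.single_zero_mul_eq_smul,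
        ← HahnSeries.single_zero_mul_eq_smul, mul_left_comm] }

/-- `d/dz` on formal series in `1/z`; with `ζ = 1/z` it is `-z^{-2} d/dζ`. -/
def ddz : Module.End ℂ (LaurentSeries ℂ) := -(zMul (-2) * LaurentSeries.derivative ℂ)

/-- `d/dz` on series `f e^{ξ(c, z)}`, in terms of `f`:
`d/dz (f e^ξ) = (df/dz + (∑ (2n+1) c_n z^{2n}) f) e^ξ`. -/
def ddzWave (c : ℕ →₀ ℂ) : Module.End ℂ (LaurentSeries ℂ) :=
  ddz + c.sum fun n a => ((2 * n + 1) * a) • zMul (2 * n)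

/-- `d/dz^q = (1/q) z^{1-q} d/dz` on series `f e^{ξ(c, z)}`, in terms of `f`. -/
def ddzPow (c : ℕ →₀ ℂ) (q : ℕ) : Module.End ℂ (LaurentSeries ℂ) :=
  (1 / (q : ℂ)) • (zMul (1 - q) * ddzWave c)

/-- `A_{2p} = z^p (d/dz^{2p}) z^{-p}` on series `f e^{ξ(c, z)}`, in terms of `f`. -/
def operatorA (c : ℕ →₀ ℂ) (p : ℕ) : Module.End ℂ (LaurentSeries ℂ) :=
  zMul p * ddzPow c (2 * p) * zMul (-p)

end BKP

end

noncomputable section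

/-! Everything is read off from symbols at the base point: `baseSymbol` sends an operator `P` to the
series `f` with `P e^ξ = f e^ξ` at `t = c`. Left multiplication by a function becomes multiplication
by its value at `c`. Right multiplication by `∂^k` becomes multiplication by `z^k`, and right
multiplication by `Γ` becomes `d/dz`, because `Γ e^ξ = ∂_z e^ξ`. Hence the plane contains the symbol
of `P W` for every differential operator `P` (`baseSymbol_mul_mem_plane`).

Big cell: the symbol of `∂^k W` is `z^k` plus lower powers, so the spanning set is triangular with
respect to the powers `z^k`, `k ≥ 0`. Reduction: `z^p` applied to the symbol of `∂^k W` is the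
symbol of `∂^k W ∂^p = ∂^k L^p W`, and `L^p` is a differential operator. String equation: the symbol
of `∂^k A_{1,1-2p} W` is `4p A_{2p}` applied to that of `∂^k W` (`baseSymbol_generator`), and
`A_{1,1-2p}` has no negative part.

The last argument needs a limit, since `Γ` is an infinite sum. For large `N` the symbol identity is
exact and independent of `N`, but the negative part of the truncated generator only tends to zero.
`mem_of_eventually_sub_mem` removes this remainder by using that the plane is complementary to
`H_-`. -/

namespace PsiDO

variable {K R : Type*} [CommRing K] [CommRing R] [Algebra K R] {δ : Derivation K R R}

/-! ### Coefficients of products; differential operators -/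

@[simp] theorem coeff_sub (a b : PsiDO δ) (k : ℤ) : (a - b).coeff k = a.coeff k - b.coeff k := by
  rw [sub_eq_add_neg, coeff_add, coeff_neg, sub_eq_add_neg]

theorem coeff_sum {ι : Type*} (s : Finset ι) (f : ι → PsiDO δ) (k : ℤ) :
    (∑ i ∈ s, f i).coeff k = ∑ i ∈ s, (f i).coeff k := by
  classical
  induction s using Finset.induction_on with
  | empty => simp
  | insert x s hx ih => rw [Finset.sum_insert hx, Finset.sum_insert hx, coeff_add, ih]

theorem coeff_D_mul (a : PsiDO δ) (k : ℤ) :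
    ((D δ : PsiDO δ) * a).coeff k = δ (a.coeff k) + a.coeff (k - 1) := by
  rw [coeff_mul, mulCoeff, finsum_eq_sum_of_support_subset (s := {((1 : ℤ), k), (1, k - 1)})]
  · rw [Finset.sum_pair (by simp only [ne_eq, Prod.mk.injEq, true_and]; omega)]
    simp [mulTerm, D, coeff_single]
  · rintro ⟨i, q⟩ hx
    simp only [Function.mem_support, mulTerm, D, coeff_single] at hx
    have hi : i = 1 := by
      by_contra h
      simp [h] at hx
    subst hi
    have hk : k ≤ 1 + q := by
      by_contra h
      simp [h] at hx
    obtain ⟨m, hm⟩ : ∃ m : ℕ, 1 + q - k = m := ⟨_, (Int.toNat_of_nonneg (by omega)).symm⟩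
    -- The binomial coefficient `(1 choose m)` vanishes for `m ≥ 2`, leaving `∂ a = a ∂ + δ a`.
    have hm2 : m < 2 := by
      by_contra h
      apply hx
      rw [hm, if_pos hk, Int.toNat_natCast, ← Nat.cast_one, Ring.choose_natCast,
        Nat.choose_eq_zero_of_lt (by omega)]
      simp
    rcases (by omega : q = k ∨ q = k - 1) with h | h <;> simp [h]

theorem coeff_single_zero_mul (r : R) (a : PsiDO δ) (k : ℤ) :
    ((single 0 r : PsiDO δ) * a).coeff k = r * a.coeff k := by
  rw [coeff_mul, mulCoeff, finsum_eq_single _ ((0 : ℤ), k)]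
  · simp [mulTerm, coeff_single]
  · rintro ⟨i, q⟩ hx
    simp only [mulTerm, coeff_single]
    split_ifs with h1 h2
    · subst h2
      have : 0 < (0 + q - k).toNat := by
        rw [Nat.pos_iff_ne_zero]
        intro h
        apply hx
        ext <;> simp
        omega
      rw [Ring.choose_zero_pos ℤ this]
      simp
    · simp
    · rfl

/-- In `∂^i r = ∑ (i choose j) δ^j(r) ∂^(i-j)` only `j = 0, 1` survive. The second term is the
derivative of the symbol of `a`; it is what turns the `x` in `Γ` into `d/dz`. -/
theorem coeff_mul_single_zero_of_iterate_eq_zero {r : R} (hr : δ (δ r) = 0) (a : PsiDO δ) (k : ℤ) :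
    (a * single 0 r).coeff k = a.coeff k * r + (k + 1) • (a.coeff (k + 1) * δ r) := by
  rw [coeff_mul, mulCoeff, finsum_eq_sum_of_support_subset (s := {(k, (0 : ℤ)), (k + 1, 0)})]
  · rw [Finset.sum_pair (by simp)]
    simp [mulTerm, coeff_single]
  · rintro ⟨i, q⟩ hx
    simp only [Function.mem_support, mulTerm, coeff_single] at hx
    have hq : q = 0 := by
      by_contra h
      simp [h] at hx
    subst hq
    have hk : k ≤ i + 0 := by
      by_contra h
      simp only [h, if_false, ne_eq, not_true_eq_false] at hx
    obtain ⟨m, hm⟩ : ∃ m : ℕ, i + 0 - k = m := ⟨_, (Int.toNat_of_nonneg (by omega)).symm⟩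
    have hm2 : m < 2 := by
      by_contra h
      obtain ⟨n, rfl⟩ : ∃ n, m = n + 1 + 1 := ⟨m - 2, by omega⟩
      apply hx
      rw [hm, if_pos hk, Int.toNat_natCast, if_pos rfl, Function.iterate_succ_apply,
        Function.iterate_succ_apply, hr, iter_zero]
      simp
    rcases (by omega : i = k ∨ i = k + 1) with h | h <;> simp [h]

theorem single_eq_mul (i : ℤ) (r : R) : (single i r : PsiDO δ) = single 0 r * single i 1 := by
  ext k
  rw [PsiDO.mul_single_one, coeff_single, coeff_single]
  simp only [sub_eq_zero]

theorem coe_D_zpow (n : ℤ) : ((D δ ^ n : (PsiDO δ)ˣ) : PsiDO δ) = single n 1 := by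
  induction n using Int.induction_on with
  | zero => rfl
  | succ n ih =>
    rw [zpow_add_one, Units.val_mul, ih, ← single_mul_single]
    rfl
  | pred n ih =>
    rw [zpow_sub_one, Units.val_mul, ih, sub_eq_add_neg, ← single_mul_single]
    rfl

theorem coeff_mul_D_zpow (a : PsiDO δ) (n k : ℤ) :
    (a * ((D δ ^ n : (PsiDO δ)ˣ) : PsiDO δ)).coeff k = a.coeff (k - n) := by
  rw [coe_D_zpow, PsiDO.mul_single_one]

theorem coeff_D_pow_mul_of_lt {a : PsiDO δ} {B : ℤ} (ha : ∀ i, B < i → a.coeff i = 0) (k : ℕ) :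
    ∀ i, B + k < i → ((D δ : PsiDO δ) ^ k * a).coeff i = 0 := by
  induction k with
  | zero => simpa using ha
  | succ k ih =>
    intro i hi
    push_cast at hi
    rw [pow_succ', mul_assoc, coeff_D_mul, ih i (by omega), ih (i - 1) (by omega), map_zero,
      add_zero]

/-- Each `∂` raises the order by one and keeps the leading coefficient, as the differentiated terms
have lower order. -/
theorem coeff_D_pow_mul_top {a : PsiDO δ} {B : ℤ} (ha : ∀ i, B < i → a.coeff i = 0) (k : ℕ) :
    ((D δ : PsiDO δ) ^ k * a).coeff (B + k) = a.coeff B := by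
  induction k with
  | zero => simp
  | succ k ih =>
    rw [pow_succ', mul_assoc, coeff_D_mul, coeff_D_pow_mul_of_lt ha k _ (by push_cast; omega),
      map_zero, zero_add, ← ih]
    congr 1
    push_cast
    ring

theorem negPart_eq_zero_iff {a : PsiDO δ} : a.negPart = 0 ↔ ∀ k < 0, a.coeff k = 0 := by
  refine ⟨fun h k hk => ?_, fun h => ?_⟩
  · simpa [negPart, hk] using congrArg (fun b : PsiDO δ => b.coeff k) h
  · ext k
    by_cases hk : k < 0 <;> simp [negPart, hk, h]

theorem coeff_D_pow_mul_of_neg {a : PsiDO δ} (ha : ∀ i < 0, a.coeff i = 0) (k : ℕ) :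
    ∀ i < 0, ((D δ : PsiDO δ) ^ k * a).coeff i = 0 := by
  induction k with
  | zero => simpa using ha
  | succ k ih =>
    intro i hi
    rw [pow_succ', mul_assoc, coeff_D_mul, ih i hi, ih (i - 1) (by omega), map_zero, add_zero]

/-- A pseudo-differential operator without negative powers of `∂` is a differential operator. -/
theorem eq_sum_of_coeff_neg_eq_zero {a : PsiDO δ} (ha : ∀ i < 0, a.coeff i = 0) :
    ∃ N : ℕ, a = ∑ k ∈ Finset.range N, single 0 (a.coeff k) * (D δ : PsiDO δ) ^ k := by
  obtain ⟨B, hB⟩ := a.bdd'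
  -- The possible exponents are `0, …, B`; there are none if `B < 0`.
  refine ⟨(B + 1).toNat, ?_⟩
  ext k
  have h (m : ℕ) : (single 0 (a.coeff m) * (D δ : PsiDO δ) ^ m).coeff k =
      if k = m then a.coeff m else 0 := by
    rw [← Units.val_pow_eq_pow_val, ← zpow_natCast, coe_D_zpow, ← single_eq_mul, coeff_single]
  rw [coeff_sum, Finset.sum_congr rfl fun m _ => h m]
  rcases lt_or_ge k 0 with hk | hk
  · rw [ha k hk, Finset.sum_eq_zero]
    intro m _
    rw [if_neg (by omega)]
  · lift k to ℕ using hk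
    simp only [Nat.cast_inj, Finset.sum_ite_eq, Finset.mem_range]
    split_ifs with h
    · rfl
    · exact hB _ (by omega)

end PsiDO

namespace BKP

open PsiDO

/-! ### Series in `z⁻¹` -/

@[simp] theorem coeff_zMul (k n : ℤ) (f : LaurentSeries ℂ) :
    (zMul k f).coeff n = f.coeff (n + k) := by
  change (HahnSeries.single (-k) 1 * f).coeff n = _
  rw [HahnSeries.coeff_single_mul, one_mul, sub_neg_eq_add]

@[simp] theorem coeff_ddz (n : ℤ) (f : LaurentSeries ℂ) :
    (ddz f).coeff n = -((n - 1 : ℂ) * f.coeff (n - 1)) := by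
  simp [ddz, LaurentSeries.hasseDeriv_coeff]
  ring_nf

theorem zMul_zMul (k l : ℤ) (f : LaurentSeries ℂ) : zMul k (zMul l f) = zMul (k + l) f := by
  ext n
  simp [add_assoc]

@[simp] theorem zMul_zero (f : LaurentSeries ℂ) : zMul 0 f = f := by
  ext n
  simp

theorem ddz_zMul (k : ℤ) (f : LaurentSeries ℂ) :
    ddz (zMul k f) = zMul k (ddz f) + (k : ℂ) • zMul (k - 1) f := by
  ext n
  simp only [HahnSeries.coeff_add, HahnSeries.coeff_smul, coeff_ddz, coeff_zMul, smul_eq_mul]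
  rw [show n + k - 1 = n - 1 + k by ring, show n + (k - 1) = n - 1 + k by ring]
  push_cast
  ring

theorem ddzWave_apply (c : ℕ →₀ ℂ) (f : LaurentSeries ℂ) :
    ddzWave c f = ddz f + ∑ n ∈ c.support, ((2 * n + 1) * c n) • zMul (2 * n) f := by
  rw [ddzWave, LinearMap.add_apply, Finsupp.sum, LinearMap.sum_apply]
  rfl

/-- The canonical commutation relation `[d/dz, z^k] = k z^{k-1}`. -/
theorem ddzWave_zMul (c : ℕ →₀ ℂ) (k : ℤ) (f : LaurentSeries ℂ) :
    ddzWave c (zMul k f) = zMul k (ddzWave c f) + (k : ℂ) • zMul (k - 1) f := by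
  rw [ddzWave_apply, ddzWave_apply, ddz_zMul, map_add, map_sum, add_right_comm]
  congr 2
  refine Finset.sum_congr rfl fun n _ => ?_
  rw [map_smul, zMul_zMul, zMul_zMul, add_comm k]

/-- Moving `z^{-p}` to the left through `d/dz` gives `A_{2p} = (1/2p) (z^{1-2p} d/dz - p z^{-2p})`.
-/
theorem operatorA_apply (c : ℕ →₀ ℂ) (p : ℕ) (f : LaurentSeries ℂ) :
    operatorA c p f = (1 / (2 * p : ℂ)) •
      (zMul (1 - 2 * p) (ddzWave c f) - (p : ℂ) • zMul (-(2 * p)) f) := by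
  change zMul p ((1 / ((2 * p : ℕ) : ℂ)) • zMul (1 - (2 * p : ℕ)) (ddzWave c (zMul (-p) f))) = _
  rw [map_smul, ddzWave_zMul, zMul_zMul, map_add, map_smul, zMul_zMul, zMul_zMul]
  push_cast
  rw [show (p : ℤ) + (1 - 2 * p) + -p = 1 - 2 * p by ring,
    show (p : ℤ) + (1 - 2 * p) + (-p - 1) = -(2 * p) by ring]
  ext n
  simp only [HahnSeries.coeff_add, HahnSeries.coeff_sub, HahnSeries.coeff_smul, smul_eq_mul]
  ring

theorem operatorA_commutator (c : ℕ →₀ ℂ) {p : ℕ} (hp : p ≠ 0) :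
    operatorA c p * zMul (2 * p) - zMul (2 * p) * operatorA c p = 1 := by
  have hp' : (2 * p : ℂ) ≠ 0 := by simpa using hp
  refine LinearMap.ext fun f => ?_
  change operatorA c p (zMul (2 * p) f) - zMul (2 * p) (operatorA c p f) = f
  rw [operatorA_apply, operatorA_apply, ddzWave_zMul, map_add, map_smul, map_smul, map_sub,
    map_smul, zMul_zMul, zMul_zMul, zMul_zMul, zMul_zMul, zMul_zMul,
    show (1 - 2 * p : ℤ) + (2 * p - 1) = 0 by ring, zMul_zero, add_comm (2 * p : ℤ) (1 - 2 * p),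
    add_comm (2 * p : ℤ) (-(2 * p))]
  push_cast
  ext n
  simp only [HahnSeries.coeff_add, HahnSeries.coeff_sub, HahnSeries.coeff_smul, smul_eq_mul]
  field_simp
  ring

/-! ### The value of a symbol at the base point -/

/-- The series `f` such that `P e^ξ = f e^ξ` at the base point `t = c`. -/
def baseSymbol : Op →+ LaurentSeries ℂ where
  toFun P := HahnSeries.ofSuppBddBelow (fun n => MvPowerSeries.constantCoeff (P.coeff (-n))) (by
    obtain ⟨N, hN⟩ := P.bdd'
    refine ⟨-N, fun n hn => ?_⟩
    by_contra h
    exact hn (by simp only [hN (-n) (by omega), map_zero]))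
  map_zero' := by ext n; simp
  map_add' a b := by ext n; simp

@[simp] theorem coeff_baseSymbol (P : Op) (n : ℤ) :
    (baseSymbol P).coeff n = MvPowerSeries.constantCoeff (P.coeff (-n)) := rfl

/-- Both `dxWave` and left multiplication by `∂` send a coefficient `a_k` to `δ a_k + a_{k-1}`. -/
theorem coeff_iterate_dxWave (W : Opˣ) (k : ℕ) (n : ℤ) :
    (dxWave^[k] (waveSeries W)).coeff n = ((D (dt 0) : Op) ^ k * (W : Op)).coeff (-n) := by
  induction k generalizing n with
  | zero => simp [waveSeries]
  | succ k ih =>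
    rw [Function.iterate_succ_apply', pow_succ', mul_assoc, coeff_D_mul, dxWave,
      HahnSeries.coeff_add, HahnSeries.coeff_single_mul, HahnSeries.map_coeff, ih, ih, one_mul]
    congr 3
    ring

theorem atBase_iterate_dxWave (W : Opˣ) (k : ℕ) :
    atBase (dxWave^[k] (waveSeries W)) = baseSymbol ((D (dt 0) : Op) ^ k * (W : Op)) := by
  ext n
  rw [atBase, HahnSeries.map_coeff, coeff_iterate_dxWave, coeff_baseSymbol]

theorem plane_eq (W : Opˣ) :
    plane W = Submodule.span ℂ
      (Set.range fun k : ℕ => baseSymbol ((D (dt 0) : Op) ^ k * (W : Op))) := by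
  simp only [plane, atBase_iterate_dxWave]

/-- This is why a span over `ℂ` at one point absorbs differential operators with variable
coefficients. -/
theorem baseSymbol_single_zero_mul (r : Coef) (P : Op) :
    baseSymbol (single 0 r * P) = MvPowerSeries.constantCoeff r • baseSymbol P := by
  ext n
  simp [coeff_single_zero_mul]

/-- On the right `∂^k` meets only `e^ξ`, so no Leibniz terms arise, even for negative `k`. -/
theorem baseSymbol_mul_D_zpow (P : Op) (k : ℤ) :
    baseSymbol (P * ((D (dt 0) ^ k : Opˣ) : Op)) = zMul k (baseSymbol P) := by
  ext n
  rw [coeff_baseSymbol, coeff_mul_D_zpow, coeff_zMul, coeff_baseSymbol, neg_add, sub_eq_add_neg]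

/-- Differential operators map the wave function into the plane. -/
theorem baseSymbol_mul_mem_plane {P : Op} (hP : ∀ i < 0, P.coeff i = 0) (W : Opˣ) :
    baseSymbol (P * (W : Op)) ∈ plane W := by
  obtain ⟨N, hN⟩ := eq_sum_of_coeff_neg_eq_zero hP
  rw [hN, Finset.sum_mul, map_sum, plane_eq]
  refine Submodule.sum_mem _ fun k _ => ?_
  rw [mul_assoc, baseSymbol_single_zero_mul]
  exact Submodule.smul_mem _ _ (Submodule.subset_span ⟨k, rfl⟩)

/-- To check that an endomorphism preserves the plane, it suffices to check it on the
derivatives of the wave function. -/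
theorem plane_le_comap {W : Opˣ} {T : Module.End ℂ (LaurentSeries ℂ)}
    (h : ∀ k : ℕ, T (baseSymbol ((D (dt 0) : Op) ^ k * (W : Op))) ∈ plane W) :
    ∀ f ∈ plane W, T f ∈ plane W := by
  intro f hf
  have : plane W ≤ (plane W).comap T := by
    conv_lhs => rw [plane_eq]
    rw [Submodule.span_le]
    rintro _ ⟨k, rfl⟩
    exact h k
  exact this hf

/-! ### The big cell -/

theorem isCompl_plane {W : Opˣ} (h0 : (W : Op).coeff 0 = 1)
    (hpos : ∀ k : ℤ, 0 < k → (W : Op).coeff k = 0) : IsCompl (plane W) Hminus := by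
  set v : ℕ → LaurentSeries ℂ := fun k => baseSymbol ((D (dt 0) : Op) ^ k * (W : Op)) with hv
  have hlt (k : ℕ) (n : ℤ) (hn : n < -k) : (v k).coeff n = 0 := by
    rw [hv, coeff_baseSymbol, coeff_D_pow_mul_of_lt hpos k _ (by omega), map_zero]
  have htop (k : ℕ) : (v k).coeff (-k) = 1 := by
    have := coeff_D_pow_mul_top hpos k
    rw [zero_add] at this
    rw [hv, coeff_baseSymbol, neg_neg, this, h0, map_one]
  have hmem (k : ℕ) : v k ∈ plane W := by
    rw [plane_eq]
    exact Submodule.subset_span ⟨k, rfl⟩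
  rw [isCompl_iff, disjoint_iff, codisjoint_iff]
  constructor
  · rw [eq_bot_iff]
    rintro f ⟨hf, hm⟩
    rw [SetLike.mem_coe, plane_eq] at hf
    obtain ⟨a, rfl⟩ := Finsupp.mem_span_range_iff_exists_finsupp.1 hf
    change (a.sum fun k r => r • v k) ∈ Hminus at hm
    by_contra hne
    have ha : a.support.Nonempty := by
      rw [Finsupp.support_nonempty_iff]
      rintro rfl
      simp at hne
    -- A nonzero combination has its highest power `z^m` from the last `v k` alone, and `m ≥ 0`
    -- contradicts membership in `H_-`.
    set m := a.support.max' ha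
    have hc : (a.sum fun k r => r • v k).coeff (-m) = a m := by
      rw [Finsupp.sum, HahnSeries.coeff_sum, Finset.sum_eq_single m]
      · rw [HahnSeries.coeff_smul, htop, smul_eq_mul, mul_one]
      · intro k hk hkm
        have : k < m := lt_of_le_of_ne (a.support.le_max' k hk) hkm
        rw [HahnSeries.coeff_smul, hlt k _ (by omega), smul_zero]
      · simp +contextual
    have h := hm (-m) (by simp)
    rw [hc] at h
    exact Finsupp.mem_support_iff.1 (a.support.max'_mem ha) h
  · rw [eq_top_iff]
    -- Induction on the number of nonnegative powers of `z` allowed: subtracting a multiple of `v N`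
    -- removes the power `z^N`.
    have key (N : ℕ) : ∀ f : LaurentSeries ℂ, (∀ n : ℤ, n ≤ -N → f.coeff n = 0) →
        f ∈ plane W ⊔ Hminus := by
      induction N with
      | zero => exact fun f hf => Submodule.mem_sup_right fun n hn => hf n (by simpa using hn)
      | succ N ih =>
        intro f hf
        rw [← sub_add_cancel f (f.coeff (-N) • v N)]
        refine Submodule.add_mem _ (ih _ fun n hn => ?_)
          (Submodule.mem_sup_left (Submodule.smul_mem _ _ (hmem N)))
        rcases hn.eq_or_lt with rfl | hn
        · simp [htop]
        · simp [hlt N n hn, hf n (by push_cast; omega)]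
    rintro f -
    obtain ⟨N, hN⟩ : ∃ N : ℕ, ∀ n : ℤ, n ≤ -N → f.coeff n = 0 := by
      refine ⟨(1 - f.order).toNat, fun n hn => HahnSeries.coeff_eq_zero_of_lt_order (by omega)⟩
    exact key N f hN

open Filter

/-! ### Reductions -/

theorem coe_lax_zpow_mul (W : Opˣ) (n : ℤ) :
    ((lax W ^ n : Opˣ) : Op) * (W : Op) = (W : Op) * ((D (dt 0) ^ n : Opˣ) : Op) := by
  rw [lax, conj_zpow, ← Units.val_mul, ← Units.val_mul, inv_mul_cancel_right]

theorem zMul_mem_plane_of_isReduced {p : ℕ} {W : Opˣ} (h : IsReduced p W) :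
    ∀ f ∈ plane W, zMul p f ∈ plane W := by
  refine plane_le_comap fun k => ?_
  -- `∂^k W ∂^p = (∂^k L^p) W`, whose bracket is a differential operator.
  rw [← baseSymbol_mul_D_zpow, mul_assoc, ← coe_lax_zpow_mul, zpow_natCast,
    Units.val_pow_eq_pow_val, ← mul_assoc]
  exact baseSymbol_mul_mem_plane (coeff_D_pow_mul_of_neg (negPart_eq_zero_iff.1 h) k) W

/-! ### The Orlov–Schulman operator -/

theorem baseSymbol_mul_single_zero (P : Op) {r : Coef} (hr : dt 0 (dt 0 r) = 0) :
    baseSymbol (P * single 0 r) = MvPowerSeries.constantCoeff r • baseSymbol P +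
      MvPowerSeries.constantCoeff (dt 0 r) • ddz (baseSymbol P) := by
  ext n
  rw [coeff_baseSymbol, coeff_mul_single_zero_of_iterate_eq_zero hr, HahnSeries.coeff_add,
    HahnSeries.coeff_smul, HahnSeries.coeff_smul, coeff_ddz, coeff_baseSymbol, coeff_baseSymbol,
    map_add, map_mul, map_zsmul, map_mul, zsmul_eq_mul, smul_eq_mul, smul_eq_mul,
    show -(n - 1) = -n + 1 by ring]
  push_cast
  ring

/-- At the base point only `c_n` survives from `c_n + s_n`. The variable `s_n` is constant in `x`
unless `n = 0`, and there its derivative `1` contributes `d/dz`. -/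
theorem baseSymbol_mul_gamma_term (c : ℕ →₀ ℂ) (P : Op) (n : ℕ) :
    baseSymbol (P * single (2 * n : ℤ)
        ((2 * n + 1 : Coef) * (MvPowerSeries.C (c n) + MvPowerSeries.X n))) =
      ((2 * n + 1) * c n) • zMul (2 * n) (baseSymbol P) +
        if n = 0 then ddz (baseSymbol P) else 0 := by
  have hn : (2 * n + 1 : Coef) = ((2 * n + 1 : ℕ) : Coef) := by push_cast; rfl
  have hd : dt 0 ((2 * n + 1 : Coef) * (MvPowerSeries.C (c n) + MvPowerSeries.X n)) =
      if n = 0 then 1 else 0 := by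
    rw [hn, ← nsmul_eq_mul, map_nsmul, map_add, MvPowerSeries.pderiv_C, zero_add,
      MvPowerSeries.pderiv_X]
    rcases eq_or_ne n 0 with rfl | h
    · simp
    · simp [h]
  have hdd : dt 0 (dt 0 ((2 * n + 1 : Coef) * (MvPowerSeries.C (c n) + MvPowerSeries.X n))) =
      0 := by
    rw [hd]
    split_ifs
    · exact Derivation.map_one_eq_zero _
    · exact map_zero _
  rw [single_eq_mul, ← coe_D_zpow, ← mul_assoc, baseSymbol_mul_D_zpow,
    baseSymbol_mul_single_zero P hdd, hd, map_add, map_smul, map_smul, hn, map_mul, map_natCast,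
    map_add, MvPowerSeries.constantCoeff_C, MvPowerSeries.constantCoeff_X, add_zero]
  push_cast
  rcases eq_or_ne n 0 with rfl | h
  · simp
  · simp only [h, if_false, map_zero, add_zero, add_eq_left]
    exact zero_smul ℂ (zMul (2 * n) (ddz (baseSymbol P)))

/-- Right multiplication by `Γ` is the derivative in `z`. -/
theorem baseSymbol_mul_gammaSum {c : ℕ →₀ ℂ} {N : ℕ} (h0 : 0 < N)
    (hN : c.support ⊆ Finset.range N) (P : Op) :
    baseSymbol (P * gammaSum c N) = ddzWave c (baseSymbol P) := by
  rw [gammaSum, Finset.mul_sum, map_sum,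
    Finset.sum_congr rfl fun n _ => baseSymbol_mul_gamma_term c P n, Finset.sum_add_distrib,
    Finset.sum_ite_eq_of_mem' _ _ _ (Finset.mem_range.2 h0), ddzWave_apply, add_comm]
  congr 1
  symm
  refine Finset.sum_subset hN fun n _ hn => ?_
  rw [Finsupp.notMem_support_iff.1 hn, mul_zero]
  exact zero_smul ℂ (zMul (2 * n) (baseSymbol P))

theorem generator_one_of_odd {l : ℤ} (hl : Odd l) (L : Opˣ) (M : Op) :
    generator 1 l L M = M * ((L ^ l : Opˣ) : Op) + ((L ^ (l - 1) : Opˣ) : Op) * M * (L : Op) := by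
  have h : ((Int.negOnePow l : ℤˣ) : ℤ) = -1 := by rw [Int.negOnePow_odd l hl]; rfl
  rw [generator, h, pow_one, sub_eq_add_neg]
  congr 1
  generalize ((L ^ (l - 1) : Opˣ) : Op) * M * (L : Op) = X
  ext k
  simp

/-- Moving `W` to the left through the Lax and Orlov–Schulman operators replaces `L` by `∂` and
`M_N` by `Γ_N`. -/
theorem generator_mul (p : ℕ) (c : ℕ →₀ ℂ) (W : Opˣ) (N : ℕ) :
    generator 1 (1 - 2 * p) (lax W) (orlovSchulmanSum c W N) * (W : Op) =
      (W : Op) * gammaSum c N * ((D (dt 0) ^ (1 - 2 * p : ℤ) : Opˣ) : Op) +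
      (W : Op) * ((D (dt 0) ^ (-(2 * p) : ℤ) : Opˣ) : Op) * gammaSum c N *
        ((D (dt 0) ^ (1 : ℤ) : Opˣ) : Op) := by
  have h1 := coe_lax_zpow_mul W 1
  rw [zpow_one] at h1
  rw [generator_one_of_odd ⟨-p, by ring⟩, add_mul, mul_assoc, coe_lax_zpow_mul, mul_assoc, h1,
    show (1 - 2 * p - 1 : ℤ) = -(2 * p) by ring, orlovSchulmanSum]
  refine congrArg₂ (· + ·) ?_ ?_
  · rw [mul_assoc, Units.inv_mul_cancel_left]
  · rw [mul_assoc _ _ ((W : Op) * _), mul_assoc ((W : Op) * _), Units.inv_mul_cancel_left,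
      ← mul_assoc, ← mul_assoc, coe_lax_zpow_mul]

/-- Right factors act on the symbol from left to right, so the two terms give `z^{1-2p} d/dz` and `z
(d/dz) z^{-2p}`. Their sum `2 z^{1-2p} d/dz - 2p z^{-2p}` is `4p A_{2p}`. -/
theorem baseSymbol_generator {p : ℕ} (hp : p ≠ 0) {c : ℕ →₀ ℂ} {N : ℕ} (h0 : 0 < N)
    (hN : c.support ⊆ Finset.range N) (W : Opˣ) (P : Op) :
    baseSymbol (P * (generator 1 (1 - 2 * p) (lax W) (orlovSchulmanSum c W N) * (W : Op))) =
      (4 * p : ℂ) • operatorA c p (baseSymbol (P * (W : Op))) := by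
  have hp' : (p : ℂ) ≠ 0 := by simpa using hp
  rw [generator_mul, mul_add, map_add]
  simp only [← mul_assoc]
  rw [baseSymbol_mul_D_zpow, baseSymbol_mul_D_zpow, baseSymbol_mul_gammaSum h0 hN,
    baseSymbol_mul_gammaSum h0 hN, baseSymbol_mul_D_zpow, ddzWave_zMul, map_add, map_smul,
    zMul_zMul, zMul_zMul, operatorA_apply, show (1 + -(2 * p) : ℤ) = 1 - 2 * p by ring,
    show (1 + (-(2 * p) - 1) : ℤ) = -(2 * p) by ring]
  ext n
  simp only [HahnSeries.coeff_add, HahnSeries.coeff_sub, HahnSeries.coeff_smul, smul_eq_mul]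
  push_cast
  field_simp
  ring

/-! ### Vanishing of the remainder -/

theorem coeff_iterate_dt_eq_zero {f : Coef} {a : ℕ} {d : ℕ →₀ ℕ}
    (h : MvPowerSeries.coeff (d + Finsupp.single 0 a) f = 0) :
    MvPowerSeries.coeff d ((dt 0)^[a] f) = 0 := by
  induction a generalizing f with
  | zero => simpa using h
  | succ a ih =>
    rw [Function.iterate_succ_apply]
    refine ih ?_
    rw [dt, MvPowerSeries.coeff_pderiv, add_assoc, ← Finsupp.single_add, h, zero_mul]

/-- Moving `∂^k` through `E` differentiates its coefficients at most `k` times and raises exponents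
by at most `k`. As `W` has order at most `0`, the coefficient of `∂^m` in `E W` involves only those
of `E` with index at least `m`, undifferentiated. -/
theorem constantCoeff_coeff_D_pow_mul_eq_zero {W : Op} (hW : ∀ i : ℤ, 0 < i → W.coeff i = 0)
    (k : ℕ) {E : Op} {j : ℤ} (hE : ∀ a ≤ k, ∀ i : ℤ, j ≤ i →
      MvPowerSeries.constantCoeff ((dt 0)^[a] (E.coeff i)) = 0) {m : ℤ} (hm : j + k ≤ m) :
    MvPowerSeries.constantCoeff (((D (dt 0) : Op) ^ k * (E * W)).coeff m) = 0 := by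
  induction k generalizing E j with
  | zero =>
    obtain ⟨B, hB⟩ := E.bdd'
    rw [pow_zero, one_mul, coeff_mul_eq_sum E W (lo := min (m - B) (m - 0)) hB hW
      (min_le_left _ _) (min_le_right _ _) le_rfl le_rfl, map_sum]
    refine Finset.sum_eq_zero fun i _ => ?_
    rw [map_sum]
    refine Finset.sum_eq_zero fun q hq => ?_
    rw [mulTerm]
    split_ifs with h
    · have := (Finset.mem_Icc.1 hq).2
      have h0 := hE 0 le_rfl i (by push_cast at hm; omega)
      rw [Function.iterate_zero_apply] at h0
      rw [map_zsmul, map_mul, h0, zero_mul, smul_zero]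
    · exact map_zero _
  | succ k ih =>
    rw [pow_succ, mul_assoc, ← mul_assoc _ E]
    refine ih (E := (D (dt 0) : Op) * E) (j := j + 1) (fun a ha i hi => ?_)
      (by push_cast at hm; omega)
    rw [coeff_D_mul, iter_add, map_add, ← Function.iterate_succ_apply,
      hE (a + 1) (by omega) i (by omega), hE a (by omega) (i - 1) (by omega), add_zero]

theorem eventually_baseSymbol_negPart {W : Op} (hW : ∀ i : ℤ, 0 < i → W.coeff i = 0)
    {G : ℕ → Op} (hG : ∀ i : ℤ, i < 0 → ∀ d : ℕ →₀ ℕ, ∀ᶠ N in atTop,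
      MvPowerSeries.coeff d ((G N).coeff i) = 0) (k : ℕ) (m : ℤ) :
    ∀ᶠ N in atTop, ∀ n ≤ m,
      (baseSymbol ((D (dt 0) : Op) ^ k * ((G N).negPart * W))).coeff n = 0 := by
  -- Only finitely many scalar coefficients matter: at most `k` derivatives in `x`, and exponents
  -- from `-m - k` up to `-1`. So the pointwise limits can be taken simultaneously.
  have h : ∀ᶠ N in atTop, ∀ a ∈ Finset.range (k + 1), ∀ i ∈ Finset.Ico (-m - k) 0,
      MvPowerSeries.coeff (Finsupp.single 0 a) ((G N).coeff i) = 0 := by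
    simp only [eventually_all_finset]
    exact fun a _ i hi => hG i (Finset.mem_Ico.1 hi).2 _
  filter_upwards [h] with N hN n hn
  rw [coeff_baseSymbol]
  refine constantCoeff_coeff_D_pow_mul_eq_zero hW k (j := -m - k) (fun a ha i hi => ?_) (by omega)
  rw [← MvPowerSeries.coeff_zero_eq_constantCoeff_apply]
  refine coeff_iterate_dt_eq_zero ?_
  rw [zero_add]
  change MvPowerSeries.coeff _ (if i < 0 then _ else _) = _
  split_ifs with hi0
  · exact hN a (Finset.mem_range.2 (by omega)) i (Finset.mem_Ico.2 ⟨hi, hi0⟩)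
  · exact map_zero _

/-- If `x` is congruent modulo a subspace complementary to `H_-` to a sequence which tends to zero
coefficientwise and uniformly to the left, then `x` lies in that subspace. -/
theorem mem_of_eventually_sub_mem {V : Submodule ℂ (LaurentSeries ℂ)} (hV : IsCompl V Hminus)
    {x : LaurentSeries ℂ} {e : ℕ → LaurentSeries ℂ} (hx : ∀ᶠ N in atTop, x - e N ∈ V)
    (he : ∀ m : ℤ, ∀ᶠ N in atTop, ∀ n ≤ m, (e N).coeff n = 0) : x ∈ V := by
  -- Taking `m = 0` puts `e N` in `H_-` from `N₁` on. Differences then lie in `V ⊓ H_- = 0`, so `e`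
  -- is eventually constant, and its limit is zero.
  obtain ⟨N₁, h₁⟩ := eventually_atTop.1 (hx.and (he 0))
  have hzero : e N₁ = 0 := by
    ext m
    obtain ⟨N, hN, hm⟩ := ((eventually_ge_atTop N₁).and (he m)).exists
    have hsub : e N - e N₁ ∈ V ⊓ Hminus := by
      refine ⟨?_, Hminus.sub_mem (h₁ N hN).2 (h₁ N₁ le_rfl).2⟩
      rw [show e N - e N₁ = (x - e N₁) - (x - e N) by abel]
      exact V.sub_mem (h₁ N₁ le_rfl).1 (h₁ N hN).1
    rw [hV.inf_eq_bot, Submodule.mem_bot, sub_eq_zero] at hsub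
    rw [← hsub, hm m le_rfl, HahnSeries.coeff_zero]
  simpa [hzero] using (h₁ N₁ le_rfl).1

theorem operatorA_mem_plane_of_stringEquation {p : ℕ} (hp : p ≠ 0) {c : ℕ →₀ ℂ} {W : Opˣ}
    (h0 : (W : Op).coeff 0 = 1) (hpos : ∀ k : ℤ, 0 < k → (W : Op).coeff k = 0)
    (h : StringEquation p c W) : ∀ f ∈ plane W, operatorA c p f ∈ plane W := by
  have hp' : (4 * p : ℂ) ≠ 0 := by simpa using hp
  refine plane_le_comap fun k => ?_
  rw [← Submodule.smul_mem_iff _ hp']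
  set G : ℕ → Op := fun N => generator 1 (1 - 2 * p) (lax W) (orlovSchulmanSum c W N) with hG
  refine mem_of_eventually_sub_mem (isCompl_plane h0 hpos)
    (e := fun N => baseSymbol ((D (dt 0) : Op) ^ k * ((G N).negPart * (W : Op)))) ?_
    (eventually_baseSymbol_negPart hpos h k)
  obtain ⟨S, hS⟩ := c.support.exists_nat_subset_range
  filter_upwards [eventually_ge_atTop S, eventually_gt_atTop 0] with N hSN hN
  -- For these `N` the target is exactly the symbol of `∂^k G_N W`; subtracting the remainder leaves
  -- that of `∂^k (G_N)_+ W`.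
  rw [← baseSymbol_generator hp hN (hS.trans (Finset.range_mono hSN)), ← map_sub, ← mul_sub,
    ← sub_mul, ← mul_assoc]
  refine baseSymbol_mul_mem_plane (coeff_D_pow_mul_of_neg (fun i hi => ?_) k) W
  rw [coeff_sub, sub_eq_zero]
  exact (if_pos hi).symm

end BKP

end

theorem mainTheorem4 (p : ℕ) (hp : Odd p) (c : ℕ →₀ ℂ) (W : BKP.Opˣ)
    (hW : BKP.IsWaveOperator W) :
    IsCompl (BKP.plane W) BKP.Hminus ∧
    (BKP.IsReduced p W → ∀ f ∈ BKP.plane W, BKP.zMul p f ∈ BKP.plane W) ∧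
    (BKP.StringEquation p c W → ∀ f ∈ BKP.plane W, BKP.operatorA c p f ∈ BKP.plane W) ∧
    BKP.operatorA c p * BKP.zMul (2 * p) - BKP.zMul (2 * p) * BKP.operatorA c p = 1 :=
  ⟨BKP.isCompl_plane hW.coeff_zero hW.coeff_pos, BKP.zMul_mem_plane_of_isReduced,
    BKP.operatorA_mem_plane_of_stringEquation hp.pos.ne' hW.coeff_zero hW.coeff_pos,
    BKP.operatorA_commutator c hp.pos.ne'⟩
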